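/- Let $2<q<\infty$ and $\frac1p+\frac1q=1$. There is a constant $C>0$ depending only on $q$ such that the following holds. Let $E$ be a (real or complex) Banach space, let $(\varepsilon_n)_{n\ge1}$ be a Rademacher sequence on a probability space (independent random variables with $P(\varepsilon_n=1)=P(\varepsilon_n=-1)=\frac12$), and let $(x_n)_{n\ge1}$ be a sequence in $E$ such that the series $X=\sum_n\varepsilon_n x_n$ converges almost surely in $E$. Then $$\frac1C\,\bigl\|\,\|X\|\,\bigr\|_{\Psi_q}\;\le\;\mathbb E\|X\|+\sup_{x^*\in E^*,\ \|x^*\|\le1}\bigl\|(x^*(x_n))\bigr\|_{p,\infty}\;\le\;C\,\bigl\|\,\|X\|\,\bigr\|_{\Psi_q},$$ where both sides are elements of $[0,\infty]$ (so that one is infinite if and only if the other is). Here $\Psi_q(t)=e^{t^q}-1$ for $t\ge 0$; $\|Y\|_{\Psi_q}=\inf\{c>0:\mathbb E\,\Psi_q(|Y|/c)\le1\}$ for a random variable $Y$ (with $\inf\emptyset=\infty$); and $\|(a_n)\|_{p,\infty}=\sup_{n\ge1}n^{1/p}a_n^*$ for a scalar sequence $(a_n)$, where $(a_n^*)_{n\ge1}$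 is the decreasing rearrangement of $(|a_n|)$, i.e. $a_n^*=\inf\{s\ge0:\#\{k:|a_k|>s\}<n\}$. -/

import Mathlib

open MeasureTheory ProbabilityTheory Filter Topology
open scoped NNReal ENNReal

/-- A Rademacher sequence on `(Ω, P)`: independent random variables, each taking the values
`1` and `-1` with probability `1/2`. -/
structure IsRademacherSequence {Ω : Type*} [MeasurableSpace Ω] (P : Measure Ω)
    (ε : ℕ → Ω → ℝ) : Prop where
  measurable : ∀ n, Measurable (ε n)
  indep : iIndepFun ε P
  prob_one : ∀ n, P {ω | ε n ω = 1} = 1 / 2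
  prob_neg_one : ∀ n, P {ω | ε n ω = -1} = 1 / 2

/-- The partial sums `∑_{n < N} ε_n x_n` converge almost surely to `X`. -/
def IsRademacherSum (𝕜 : Type*) [RCLike 𝕜] {E : Type*} [NormedAddCommGroup E] [NormedSpace 𝕜 E]
    {Ω : Type*} [MeasurableSpace Ω] (P : Measure Ω) (ε : ℕ → Ω → ℝ) (x : ℕ → E)
    (X : Ω → E) : Prop :=
  ∀ᵐ ω ∂P, Tendsto (fun N : ℕ => ∑ n ∈ Finset.range N, (RCLike.ofReal (ε n ω) : 𝕜) • x n)
    atTop (𝓝 (X ω))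

/-- The Orlicz function `Ψ_q(t) = exp (t ^ q) - 1`, for `t ≥ 0`. -/
noncomputable def orliczPsi (q t : ℝ) : ℝ := Real.exp (t ^ q) - 1

/-- The Orlicz norm `inf {c > 0 : 𝔼 Ψ(|Y| / c) ≤ 1}`, equal to `∞` if there is no such `c`. -/
noncomputable def orliczNorm {Ω : Type*} [MeasurableSpace Ω] (P : Measure Ω) (Ψ : ℝ → ℝ)
    (Y : Ω → ℝ) : ℝ≥0∞ :=
  ⨅ (c : ℝ) (_ : 0 < c) (_ : ∫⁻ ω, ENNReal.ofReal (Ψ (|Y ω| / c)) ∂P ≤ 1), ENNReal.ofReal c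

/-- The decreasing rearrangement of `(|a_k|)`, indexed from `0`: the value at `n` is the infimum
of the `s ≥ 0` such that at most `n` of the `|a_k|` exceed `s`, i.e. the `(n+1)`-st largest
`|a_k|` when `a_k → 0`. -/
noncomputable def decreasingRearrangement {F : Type*} [NormedAddCommGroup F] (a : ℕ → F)
    (n : ℕ) : ℝ≥0∞ :=
  ⨅ (s : ℝ≥0) (_ : {k : ℕ | s < ‖a k‖₊}.encard ≤ n), (s : ℝ≥0∞)

/-- The weak-`ℓ_p` norm `sup_{n ≥ 1} n ^ (1/p) a*_n` (with `n` shifted to start at `0`). -/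
noncomputable def weakLpSeqNorm {F : Type*} [NormedAddCommGroup F] (p : ℝ) (a : ℕ → F) : ℝ≥0∞ :=
  ⨆ n : ℕ, ((n + 1 : ℕ) : ℝ≥0∞) ^ (1 / p) * decreasingRearrangement a n

/-! Upper bound on the Orlicz norm. Let m dominate both the mean of ‖X‖ and the weak-ℓ_p norms. The
target is E exp(r‖X‖/m) ≤ exp(C r^p) for all r ≥ 1; optimising over r then gives the Ψ_q bound,
since t^p and t^q are conjugate powers. The norm is a supremum of scalar Rademacher sums over the
dual unit ball. For such suprema `patternAvg_exp_le` bounds the exponential moment by exp of the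
mean, at the price of a correction 2 ∑ b_k² for the selected coefficients. The scaled coefficients
(r/m) Re f(x_k) need not have square sum of order r^p because of their large entries, so they are
cut at level 1. Weak ℓ_p with 1 < p < 2 makes the large entries contribute O(r^p) to the ℓ_1 norm
and the small ones O(r^p) to the square sum (`patternAvg_exp_norm_le`). Contraction and Fatou pass
to the infinite series.

Lower bound. The mean is controlled because t ≤ 1 + Ψ_q(t). If |f(x_k)| ≥ s on a set of n indices,
some sign pattern, of probability 2^(-n), gives the subseries norm at least ns/2. By contraction
Ψ_q(ns/2c) ≤ 2^n, which forces n^(1/p) s ≤ 4c (`IsRademacherSum.rpow_card_mul_le`). -/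

/-! ### Averages over sign patterns and the exponential inequality -/

/-- The sign of `k` in the sign pattern that is `1` on `A` and `-1` off `A`. -/
noncomputable def patternSign (A : Finset ℕ) (k : ℕ) : ℝ := if k ∈ A then 1 else -1

/-- The average of `F` over all subsets of `I`. -/
noncomputable def patternAvg (I : Finset ℕ) (F : Finset ℕ → ℝ) : ℝ :=
  (2⁻¹ : ℝ) ^ I.card * ∑ A ∈ I.powerset, F A

lemma patternAvg_insert {I : Finset ℕ} {j : ℕ} (hj : j ∉ I) (F : Finset ℕ → ℝ) :
    patternAvg (insert j I) F =
      (patternAvg I (fun A => F (insert j A)) + patternAvg I F) / 2 := by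
  simp only [patternAvg, Finset.card_insert_of_notMem hj, Finset.sum_powerset_insert hj]
  ring

lemma patternAvg_mono {I : Finset ℕ} {F G : Finset ℕ → ℝ} (h : ∀ A ⊆ I, F A ≤ G A) :
    patternAvg I F ≤ patternAvg I G := by
  unfold patternAvg
  gcongr with A hA
  exact h A (Finset.mem_powerset.1 hA)

lemma patternAvg_congr {I : Finset ℕ} {F G : Finset ℕ → ℝ} (h : ∀ A ⊆ I, F A = G A) :
    patternAvg I F = patternAvg I G :=
  le_antisymm (patternAvg_mono fun A hA => (h A hA).le) (patternAvg_mono fun A hA => (h A hA).ge)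

lemma patternAvg_add (I : Finset ℕ) (F G : Finset ℕ → ℝ) :
    patternAvg I (fun A => F A + G A) = patternAvg I F + patternAvg I G := by
  simp [patternAvg, Finset.sum_add_distrib, mul_add]

lemma patternAvg_const_mul (I : Finset ℕ) (c : ℝ) (F : Finset ℕ → ℝ) :
    patternAvg I (fun A => c * F A) = c * patternAvg I F := by
  simp only [patternAvg, ← Finset.mul_sum]
  ring

lemma patternAvg_const (I : Finset ℕ) (c : ℝ) : patternAvg I (fun _ => c) = c := by
  simp [patternAvg, Finset.card_powerset]

lemma exp_le_one_add_add_sq {u : ℝ} (hu : |u| ≤ 1) : Real.exp u ≤ 1 + u + u ^ 2 := by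
  have := abs_le.1 (Real.abs_exp_sub_one_sub_id_le hu)
  linarith [this.2]

/-- After division by exp(D/2), second-order bounds on both exponentials suffice: their linear and
quadratic terms add up to at most zero. -/
lemma exp_sub_sq_add_one_le {D : ℝ} (h0 : 0 ≤ D) (h1 : D ≤ 1) :
    Real.exp (D - D ^ 2 / 2) + 1 ≤ 2 * Real.exp (D / 2) := by
  have e1 : Real.exp (D - D ^ 2 / 2) = Real.exp (D / 2) * Real.exp (D / 2 - D ^ 2 / 2) := by
    rw [← Real.exp_add]; ring_nf
  have e2 : (1 : ℝ) = Real.exp (D / 2) * Real.exp (-(D / 2)) := by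
    rw [← Real.exp_add]; simp
  have h2 : Real.exp (D / 2 - D ^ 2 / 2) ≤ 1 + (D / 2 - D ^ 2 / 2) + (D / 2 - D ^ 2 / 2) ^ 2 :=
    exp_le_one_add_add_sq (by rw [abs_le]; constructor <;> nlinarith)
  have h3 : Real.exp (-(D / 2)) ≤ 1 + (-(D / 2)) + (-(D / 2)) ^ 2 :=
    exp_le_one_add_add_sq (by rw [abs_le]; constructor <;> linarith)
  have h4 : Real.exp (D / 2 - D ^ 2 / 2) + Real.exp (-(D / 2)) ≤ 2 := by
    have h5 : (D / 2 - D ^ 2 / 2) ^ 2 ≤ (D / 2) ^ 2 :=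
      pow_le_pow_left₀ (by nlinarith) (by nlinarith) 2
    nlinarith
  nlinarith [mul_le_mul_of_nonneg_left h4 (Real.exp_pos (D / 2)).le]

/-- One-coordinate step of the induction in `patternAvg_exp_le`: u and v are the two conditional
means of φ, and mixing them with weight r costs r²/2. -/
lemma exists_weight_exp_add_exp_le {u v : ℝ} (h : v ≤ u) :
    ∃ r ∈ Set.Icc (0 : ℝ) 1,
      (Real.exp ((1 - r) * u + r * v + r ^ 2 / 2) + Real.exp v) / 2 ≤ Real.exp ((u + v) / 2) := by
  rcases le_total (u - v) 1 with h1 | h1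
  -- The minimiser over [0, 1] of (1 - r)(u - v) + r²/2 is r = min(u - v, 1).
  · refine ⟨u - v, ⟨by linarith, h1⟩, ?_⟩
    have key := exp_sub_sq_add_one_le (D := u - v) (by linarith) h1
    have e1 : (1 - (u - v)) * u + (u - v) * v + (u - v) ^ 2 / 2
        = v + ((u - v) - (u - v) ^ 2 / 2) := by ring
    have e2 : (u + v) / 2 = v + (u - v) / 2 := by ring
    rw [e1, e2, Real.exp_add, Real.exp_add]
    nlinarith [Real.exp_pos v]
  · refine ⟨1, by simp, ?_⟩
    have e1 : (1 - 1) * u + 1 * v + (1 : ℝ) ^ 2 / 2 = v + 1 / 2 := by ring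
    have h2 : Real.exp (v + 1 / 2) ≤ Real.exp ((u + v) / 2) := Real.exp_le_exp.2 (by linarith)
    have h3 : Real.exp v ≤ Real.exp ((u + v) / 2) := Real.exp_le_exp.2 (by linarith)
    rw [e1]
    linarith

/-- An exponential inequality for suprema of Rademacher sums: `φ` dominates all the sums, and
`τ` selects one of them for each sign pattern. -/
theorem patternAvg_exp_le {T : Type*} (I : Finset ℕ) (b : T → ℕ → ℝ) (c : T → ℝ)
    (τ : Finset ℕ → T) (φ : Finset ℕ → ℝ)
    (h : ∀ A ⊆ I, ∀ t, c t + ∑ k ∈ I, patternSign A k * b t k ≤ φ A) :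
    patternAvg I (fun A => Real.exp (c (τ A) +
      ∑ k ∈ I, (patternSign A k * b (τ A) k - 2 * b (τ A) k ^ 2))) ≤
        Real.exp (patternAvg I φ) := by
  classical
  induction I using Finset.induction_on generalizing c τ φ with
  | empty =>
    have := h ∅ (by simp) (τ ∅)
    simpa [patternAvg] using this
  | insert j I hj ih =>
    have sum_congr_pos (A : Finset ℕ) (t : T) :
        ∑ k ∈ I, patternSign (insert j A) k * b t k = ∑ k ∈ I, patternSign A k * b t k :=
      Finset.sum_congr rfl fun k hk => by
        have : k ≠ j := fun e => hj (e ▸ hk)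
        simp [patternSign, this]
    have sum_congr_pos' (A : Finset ℕ) (t : T) :
        ∑ k ∈ I, (patternSign (insert j A) k * b t k - 2 * b t k ^ 2) =
          ∑ k ∈ I, (patternSign A k * b t k - 2 * b t k ^ 2) := by
      simp only [Finset.sum_sub_distrib, sum_congr_pos]
    have hp (A) (hA : A ⊆ I) (t : T) :
        c t + b t j + ∑ k ∈ I, patternSign A k * b t k ≤ φ (insert j A) := by
      have := h (insert j A) (Finset.insert_subset_insert j hA) t
      rw [Finset.sum_insert hj, sum_congr_pos] at this
      have e : patternSign (insert j A) j = 1 := by simp [patternSign]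
      rw [e] at this
      linarith
    have hm (A) (hA : A ⊆ I) (t : T) :
        c t - b t j + ∑ k ∈ I, patternSign A k * b t k ≤ φ A := by
      have := h A (hA.trans (Finset.subset_insert j I)) t
      rw [Finset.sum_insert hj] at this
      have hjA : j ∉ A := fun e => hj (hA e)
      have e : patternSign A j = -1 := by simp [patternSign, hjA]
      rw [e] at this
      linarith
    rw [patternAvg_insert hj, patternAvg_insert hj]
    set u := patternAvg I (fun A => φ (insert j A)) with hu
    set v := patternAvg I φ with hv
    have bound_pos (r : ℝ) (hr : r ∈ Set.Icc (0 : ℝ) 1) :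
        patternAvg I (fun A => Real.exp (c (τ (insert j A)) + ∑ k ∈ insert j I,
          (patternSign (insert j A) k * b (τ (insert j A)) k - 2 * b (τ (insert j A)) k ^ 2))) ≤
            Real.exp ((1 - r) * u + r * v + r ^ 2 / 2) := by
      -- The mixture of the two halves of φ dominates the sum with (1 - 2r) b_j + r²/2 in the j-th
      -- place, and this exceeds b_j - 2b_j² by (r - 2b_j)²/2. The j-th term is absorbed into c,
      -- which is why c varies in the induction.
      have := ih (fun t => c t + b t j - 2 * b t j ^ 2) (fun A => τ (insert j A))
        (fun A => (1 - r) * φ (insert j A) + r * φ A + r ^ 2 / 2) (fun A hA t => by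
          have h1 := mul_le_mul_of_nonneg_left (hp A hA t) (sub_nonneg.2 hr.2)
          have h2 := mul_le_mul_of_nonneg_left (hm A hA t) hr.1
          nlinarith [sq_nonneg (r - 2 * b t j)])
      rw [patternAvg_add, patternAvg_add, patternAvg_const_mul, patternAvg_const_mul,
        patternAvg_const] at this
      refine le_trans (le_of_eq (patternAvg_congr fun A _ => ?_)) this
      rw [Finset.sum_insert hj, sum_congr_pos']
      simp only [patternSign, Finset.mem_insert, true_or, if_true, one_mul]
      ring_nf
    have bound_neg (r : ℝ) (hr : r ∈ Set.Icc (0 : ℝ) 1) :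
        patternAvg I (fun A => Real.exp (c (τ A) + ∑ k ∈ insert j I,
          (patternSign A k * b (τ A) k - 2 * b (τ A) k ^ 2))) ≤
            Real.exp ((1 - r) * v + r * u + r ^ 2 / 2) := by
      have := ih (fun t => c t - b t j - 2 * b t j ^ 2) τ
        (fun A => (1 - r) * φ A + r * φ (insert j A) + r ^ 2 / 2) (fun A hA t => by
          have h1 := mul_le_mul_of_nonneg_left (hm A hA t) (sub_nonneg.2 hr.2)
          have h2 := mul_le_mul_of_nonneg_left (hp A hA t) hr.1
          nlinarith [sq_nonneg (r + 2 * b t j)])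
      rw [patternAvg_add, patternAvg_add, patternAvg_const_mul, patternAvg_const_mul,
        patternAvg_const] at this
      refine le_trans (le_of_eq (patternAvg_congr fun A hA => ?_)) this
      have hjA : j ∉ A := fun e => hj (hA e)
      have e : patternSign A j = -1 := by simp [patternSign, hjA]
      rw [Finset.sum_insert hj, e]
      ring_nf
    have zero_mem : (0 : ℝ) ∈ Set.Icc (0 : ℝ) 1 := by simp
    -- Only the half with the larger mean is mixed; the other is used with r = 0.
    rcases le_total v u with huv | huv
    · obtain ⟨r, hr, hle⟩ := exists_weight_exp_add_exp_le huv
      have h1 := bound_pos r hr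
      have h2 := bound_neg 0 zero_mem
      have e : (1 - 0) * v + 0 * u + (0 : ℝ) ^ 2 / 2 = v := by ring
      rw [e] at h2
      linarith
    · obtain ⟨r, hr, hle⟩ := exists_weight_exp_add_exp_le huv
      have h1 := bound_neg r hr
      have h2 := bound_pos 0 zero_mem
      have e : (1 - 0) * u + 0 * v + (0 : ℝ) ^ 2 / 2 = u := by ring
      rw [e] at h2
      rw [add_comm u v]
      linarith

/-! ### Signed vector sums, and dyadic sums under weak-ℓ_p control -/

/-- The vector sum of the `x k`, `k ∈ I`, with the signs of the pattern `A`. -/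
noncomputable def patternSum (𝕜 : Type*) [RCLike 𝕜] {E : Type*} [NormedAddCommGroup E]
    [NormedSpace 𝕜 E] (x : ℕ → E) (I A : Finset ℕ) : E :=
  ∑ k ∈ I, (RCLike.ofReal (patternSign A k) : 𝕜) • x k

/-- The dyadic level 2^i holds at most R 2^(-ip) indices, each contributing at most 2 · 2^i; the
geometric series converges because p > 1. -/
lemma sum_large_le_of_card_le {p : ℝ} (hp : 1 < p) (I : Finset ℕ) (g : ℕ → ℝ) (R : ℝ)
    (hg : ∀ u : ℝ, 0 < u → ∀ F ⊆ I, (∀ k ∈ F, u ≤ g k) → (F.card : ℝ) ≤ R * u ^ (-p)) :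
    ∑ k ∈ I with 1 < g k, g k ≤ 2 / (1 - (2 : ℝ) ^ (1 - p)) * R := by
  have hR : 0 ≤ R := by simpa using hg 1 one_pos ∅ (by simp) (by simp)
  have hρ : (2 : ℝ) ^ (1 - p) < 1 := Real.rpow_lt_one_of_one_lt_of_neg one_lt_two (by linarith)
  have hρ0 : 0 ≤ (2 : ℝ) ^ (1 - p) := by positivity
  have ex (k : ℕ) : ∃ n : ℕ, 1 < g k → (2 : ℝ) ^ n ≤ g k ∧ g k < 2 ^ (n + 1) := by
    by_cases h : 1 < g k
    · obtain ⟨n, hn⟩ := exists_nat_pow_near h.le (one_lt_two (α := ℝ))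
      exact ⟨n, fun _ => hn⟩
    · exact ⟨0, fun h' => absurd h' h⟩
  choose n hn using ex
  set J := I.filter fun k => 1 < g k
  calc ∑ k ∈ J, g k ≤ ∑ k ∈ J, (fun i : ℕ => (2 : ℝ) * 2 ^ i) (n k) := by
        refine Finset.sum_le_sum fun k hk => ?_
        have := (hn k (Finset.mem_filter.1 hk).2).2
        rw [pow_succ] at this
        dsimp only
        linarith
    _ = ∑ i ∈ J.image n, (J.filter fun k => n k = i).card • ((2 : ℝ) * 2 ^ i) :=
        Finset.sum_comp (fun i : ℕ => (2 : ℝ) * 2 ^ i) n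
    _ ≤ ∑ i ∈ J.image n, 2 * R * ((2 : ℝ) ^ (1 - p)) ^ i := by
        refine Finset.sum_le_sum fun i _ => ?_
        have hc := hg (2 ^ i) (by positivity) (J.filter fun k => n k = i)
          ((Finset.filter_subset _ _).trans (Finset.filter_subset _ _)) (fun k hk => by
            obtain ⟨hkJ, rfl⟩ := Finset.mem_filter.1 hk
            exact (hn k (Finset.mem_filter.1 hkJ).2).1)
        rw [nsmul_eq_mul]
        have e : ((2 : ℝ) ^ (1 - p)) ^ i = (2 ^ i) ^ (-p) * 2 ^ i := by
          rw [← Real.rpow_natCast (2 ^ (1 - p)), ← Real.rpow_mul zero_le_two,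
            ← Real.rpow_natCast 2 i, ← Real.rpow_mul zero_le_two, ← Real.rpow_add two_pos]
          ring_nf
        rw [e]
        have := mul_le_mul_of_nonneg_right hc (show (0 : ℝ) ≤ 2 * 2 ^ i by positivity)
        linarith
    _ ≤ ∑' i : ℕ, 2 * R * ((2 : ℝ) ^ (1 - p)) ^ i :=
        ((summable_geometric_of_lt_one hρ0 hρ).mul_left _).sum_le_tsum _
          (fun i _ => by positivity)
    _ = 2 / (1 - (2 : ℝ) ^ (1 - p)) * R := by
        rw [tsum_mul_left, tsum_geometric_of_lt_one hρ0 hρ]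
        ring

/-- The same count on the levels 2^(-i), now with squares: convergence needs p < 2, which is where q
> 2 enters. -/
lemma sum_small_sq_le_of_card_le {p : ℝ} (hp : p < 2) (I : Finset ℕ) (g : ℕ → ℝ)
    (g0 : ∀ k, 0 ≤ g k) (R : ℝ)
    (hg : ∀ u : ℝ, 0 < u → ∀ F ⊆ I, (∀ k ∈ F, u ≤ g k) → (F.card : ℝ) ≤ R * u ^ (-p)) :
    ∑ k ∈ I with g k ≤ 1, g k ^ 2 ≤ 2 ^ p / (1 - (2 : ℝ) ^ (p - 2)) * R := by
  have hR : 0 ≤ R := by simpa using hg 1 one_pos ∅ (by simp) (by simp)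
  have hρ : (2 : ℝ) ^ (p - 2) < 1 := Real.rpow_lt_one_of_one_lt_of_neg one_lt_two (by linarith)
  have hρ0 : 0 ≤ (2 : ℝ) ^ (p - 2) := by positivity
  have ex (k : ℕ) : ∃ n : ℕ, 0 < g k → g k ≤ 1 →
      (2⁻¹ : ℝ) ^ (n + 1) < g k ∧ g k ≤ 2⁻¹ ^ n := by
    by_cases h : 0 < g k ∧ g k ≤ 1
    · obtain ⟨n, hn⟩ := exists_nat_pow_near_of_lt_one h.1 h.2 (y := (2⁻¹ : ℝ)) (by norm_num)
        (by norm_num)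
      exact ⟨n, fun _ _ => hn⟩
    · exact ⟨0, fun h' h'' => absurd ⟨h', h''⟩ h⟩
  choose n hn using ex
  set J := I.filter fun k => 0 < g k ∧ g k ≤ 1
  calc ∑ k ∈ I with g k ≤ 1, g k ^ 2 = ∑ k ∈ J, g k ^ 2 := by
        refine (Finset.sum_subset (fun k hk => ?_) fun k hk hk' => ?_).symm
        · simp only [J, Finset.mem_filter] at hk ⊢
          exact ⟨hk.1, hk.2.2⟩
        · simp only [J, Finset.mem_filter, not_and] at hk hk'
          have : g k = 0 := le_antisymm (not_lt.1 fun h => hk' hk.1 h hk.2) (g0 k)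
          simp [this]
    _ ≤ ∑ k ∈ J, (fun i : ℕ => ((2⁻¹ : ℝ) ^ i) ^ 2) (n k) := by
        refine Finset.sum_le_sum fun k hk => ?_
        have h := (Finset.mem_filter.1 hk).2
        exact pow_le_pow_left₀ h.1.le (hn k h.1 h.2).2 2
    _ = ∑ i ∈ J.image n, (J.filter fun k => n k = i).card • (((2⁻¹ : ℝ) ^ i) ^ 2) :=
        Finset.sum_comp (fun i : ℕ => ((2⁻¹ : ℝ) ^ i) ^ 2) n
    _ ≤ ∑ i ∈ J.image n, 2 ^ p * R * ((2 : ℝ) ^ (p - 2)) ^ i := by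
        refine Finset.sum_le_sum fun i _ => ?_
        have hc := hg (2⁻¹ ^ (i + 1)) (by positivity) (J.filter fun k => n k = i)
          ((Finset.filter_subset _ _).trans (Finset.filter_subset _ _)) (fun k hk => by
            obtain ⟨hkJ, rfl⟩ := Finset.mem_filter.1 hk
            have h := (Finset.mem_filter.1 hkJ).2
            exact (hn k h.1 h.2).1.le)
        rw [nsmul_eq_mul]
        have e : (2 : ℝ) ^ p * ((2 : ℝ) ^ (p - 2)) ^ i
            = (2⁻¹ ^ (i + 1)) ^ (-p) * (2⁻¹ ^ i) ^ 2 := by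
          rw [← Real.rpow_natCast (2 ^ (p - 2)), ← Real.rpow_mul zero_le_two,
            ← Real.rpow_natCast 2⁻¹ i, ← Real.rpow_natCast 2⁻¹ (i + 1),
            ← Real.rpow_natCast _ 2, Real.inv_rpow zero_le_two,
            Real.inv_rpow zero_le_two, ← Real.rpow_neg zero_le_two, ← Real.rpow_neg zero_le_two,
            ← Real.rpow_mul zero_le_two, ← Real.rpow_mul zero_le_two,
            ← Real.rpow_add two_pos, ← Real.rpow_add two_pos]
          push_cast
          ring_nf
        have := mul_le_mul_of_nonneg_right hc (show (0 : ℝ) ≤ (2⁻¹ ^ i) ^ 2 by positivity)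
        nlinarith
    _ ≤ ∑' i : ℕ, 2 ^ p * R * ((2 : ℝ) ^ (p - 2)) ^ i :=
        ((summable_geometric_of_lt_one hρ0 hρ).mul_left _).sum_le_tsum _
          (fun i _ => by positivity)
    _ = 2 ^ p / (1 - (2 : ℝ) ^ (p - 2)) * R := by
        rw [tsum_mul_left, tsum_geometric_of_lt_one hρ0 hρ]
        ring

lemma card_le_of_weakLpSeqNorm_le {F : Type*} [NormedAddCommGroup F] {p m u : ℝ} (hp : 0 < p)
    (hm : 0 < m) (hu : 0 < u) (a : ℕ → F) (ha : weakLpSeqNorm p a ≤ ENNReal.ofReal m)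
    (S : Finset ℕ) (hS : ∀ k ∈ S, u ≤ ‖a k‖) : (S.card : ℝ) ≤ (m / u) ^ p := by
  obtain hc | hc := Nat.eq_zero_or_pos S.card
  · rw [hc]; simp; positivity
  -- The rearrangement is indexed from 0, so a set of n + 1 indices bounds its value at n.
  obtain ⟨n, hn⟩ : ∃ n, S.card = n + 1 := ⟨S.card - 1, by omega⟩
  have h1 : ENNReal.ofReal u ≤ decreasingRearrangement a n := by
    refine le_iInf₂ fun s hs => ?_
    by_contra! hlt
    have hsu : (s : ℝ) < u := by
      rwa [← ENNReal.ofReal_coe_nnreal, ENNReal.ofReal_lt_ofReal_iff hu] at hlt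
    have hsub : (S : Set ℕ) ⊆ {k : ℕ | s < ‖a k‖₊} := fun k hk => by
      have := hS k hk
      simp only [Set.mem_ofPred_eq]
      rw [← NNReal.coe_lt_coe, coe_nnnorm]
      linarith
    have := (Set.encard_le_encard hsub).trans hs
    rw [Set.encard_coe_eq_coe_finsetCard, hn] at this
    norm_cast at this
    omega
  have h2 : ((n + 1 : ℕ) : ℝ≥0∞) ^ (1 / p) * ENNReal.ofReal u ≤ ENNReal.ofReal m :=
    le_trans (by gcongr) ((le_iSup (fun n : ℕ => ((n + 1 : ℕ) : ℝ≥0∞) ^ (1 / p) *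
      decreasingRearrangement a n) n).trans ha)
  rw [← ENNReal.ofReal_natCast, ENNReal.ofReal_rpow_of_pos (by positivity),
    ← ENNReal.ofReal_mul (by positivity), ENNReal.ofReal_le_ofReal_iff hm.le] at h2
  rw [hn]
  have h3 : ((n + 1 : ℕ) : ℝ) ^ (1 / p) ≤ m / u := (le_div_iff₀ hu).2 h2
  have h4 := Real.rpow_le_rpow (by positivity) h3 hp.le
  rwa [← Real.rpow_mul (by positivity), one_div_mul_cancel hp.ne', Real.rpow_one] at h4

/-! ### Laws of Rademacher sequences and the contraction principle -/

section Rademacher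

set_option linter.unusedSectionVars false

variable {Ω : Type*} [MeasurableSpace Ω] {P : Measure Ω} [IsProbabilityMeasure P]

lemma ae_eq_one_or_eq_neg_one {Y : Ω → ℝ} (hY : Measurable Y) (h1 : P {ω | Y ω = 1} = 1 / 2)
    (h2 : P {ω | Y ω = -1} = 1 / 2) : ∀ᵐ ω ∂P, Y ω = 1 ∨ Y ω = -1 := by
  have m1 : MeasurableSet {ω | Y ω = 1} := hY (measurableSet_singleton 1)
  have m2 : MeasurableSet {ω | Y ω = -1} := hY (measurableSet_singleton (-1))
  have hd : Disjoint {ω | Y ω = 1} {ω | Y ω = -1} := by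
    rw [Set.disjoint_left]
    intro ω h h'
    simp only [Set.mem_ofPred_eq] at h h'
    norm_num [h] at h'
  have h3 : P ({ω | Y ω = 1} ∪ {ω | Y ω = -1}) = 1 := by
    rw [measure_union hd m2, h1, h2, ENNReal.add_halves]
  have := (prob_compl_eq_zero_iff (m1.union m2)).2 h3
  exact this

lemma map_eq_half_dirac {Y : Ω → ℝ} (hY : Measurable Y) (h1 : P {ω | Y ω = 1} = 1 / 2)
    (h2 : P {ω | Y ω = -1} = 1 / 2) :
    P.map Y = (1 / 2 : ℝ≥0∞) • Measure.dirac 1 + (1 / 2 : ℝ≥0∞) • Measure.dirac (-1) := by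
  ext s hs
  have hae := ae_eq_one_or_eq_neg_one hY h1 h2
  have m1 : MeasurableSet {ω | Y ω = 1} := hY (measurableSet_singleton 1)
  rw [Measure.map_apply hY hs, ← measure_inter_add_sdiff _ m1]
  have e1 : P (Y ⁻¹' s ∩ {ω | Y ω = 1}) = 1 / 2 * s.indicator 1 (1 : ℝ) := by
    by_cases h : (1 : ℝ) ∈ s
    · have : Y ⁻¹' s ∩ {ω | Y ω = 1} = {ω | Y ω = 1} :=
        Set.inter_eq_right.2 fun ω (hω : Y ω = 1) => by simpa [hω] using h
      simp [this, h1, h]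
    · have : Y ⁻¹' s ∩ {ω | Y ω = 1} = ∅ := by
        ext ω
        simp only [Set.mem_inter_iff, Set.mem_preimage, Set.mem_ofPred_eq, Set.mem_empty_iff_false,
          iff_false, not_and]
        intro h' e
        exact h (e ▸ h')
      simp [this, h]
  have e2 : P (Y ⁻¹' s \ {ω | Y ω = 1}) = 1 / 2 * s.indicator 1 (-1 : ℝ) := by
    by_cases h : (-1 : ℝ) ∈ s
    · have : (Y ⁻¹' s \ {ω | Y ω = 1} : Set Ω) =ᵐ[P] {ω | Y ω = -1} := by
        rw [eventuallyEq_set]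
        filter_upwards [hae] with ω hω
        simp only [Set.mem_sdiff, Set.mem_preimage, Set.mem_ofPred_eq]
        rcases hω with e | e <;> rw [e] <;> norm_num [h]
      simp [measure_congr this, h2, h]
    · have : (Y ⁻¹' s \ {ω | Y ω = 1} : Set Ω) =ᵐ[P] (∅ : Set Ω) := by
        rw [eventuallyEq_set]
        filter_upwards [hae] with ω hω
        simp only [Set.mem_sdiff, Set.mem_preimage, Set.mem_ofPred_eq]
        rcases hω with e | e <;> rw [e] <;> norm_num [h]
      simp [measure_congr this, h]
  rw [e1, e2]
  simp [hs]

lemma IsRademacherSequence.identDistrib {ε ε' : ℕ → Ω → ℝ} (h : IsRademacherSequence P ε)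
    (h' : IsRademacherSequence P ε') :
    IdentDistrib (fun ω n => ε n ω) (fun ω n => ε' n ω) P P where
  aemeasurable_fst := (measurable_pi_iff.2 h.measurable).aemeasurable
  aemeasurable_snd := (measurable_pi_iff.2 h'.measurable).aemeasurable
  map_eq := by
    rw [h.indep.map_fun_eq_infinitePi_map h.measurable,
      h'.indep.map_fun_eq_infinitePi_map h'.measurable]
    congr 1
    ext1 n
    rw [map_eq_half_dirac (h.measurable n) (h.prob_one n) (h.prob_neg_one n),
      map_eq_half_dirac (h'.measurable n) (h'.prob_one n) (h'.prob_neg_one n)]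

lemma IsRademacherSequence.patternSign_mul {ε : ℕ → Ω → ℝ} (h : IsRademacherSequence P ε)
    (A : Finset ℕ) : IsRademacherSequence P (fun n ω => patternSign A n * ε n ω) where
  measurable n := (h.measurable n).const_mul _
  indep := h.indep.comp (fun n t => patternSign A n * t) fun n => measurable_const_mul _
  prob_one n := by
    by_cases hn : n ∈ A
    · simpa [patternSign, hn] using h.prob_one n
    · simpa [patternSign, hn, neg_eq_iff_eq_neg] using h.prob_neg_one n
  prob_neg_one n := by
    by_cases hn : n ∈ A
    · simpa [patternSign, hn] using h.prob_neg_one n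
    · simpa [patternSign, hn] using h.prob_one n

lemma IsRademacherSequence.ae_sign {ε : ℕ → Ω → ℝ} (h : IsRademacherSequence P ε) :
    ∀ᵐ ω ∂P, ∀ n, ε n ω = 1 ∨ ε n ω = -1 :=
  ae_all_iff.2 fun n => ae_eq_one_or_eq_neg_one (h.measurable n) (h.prob_one n) (h.prob_neg_one n)

/-- The set of indices in `I` at which the sign is `1`. -/
noncomputable def positiveSet (ε : ℕ → Ω → ℝ) (I : Finset ℕ) (ω : Ω) : Finset ℕ :=
  open Classical in I.filter fun k => ε k ω = 1

lemma positiveSet_subset (ε : ℕ → Ω → ℝ) (I : Finset ℕ) (ω : Ω) : positiveSet ε I ω ⊆ I :=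
  Finset.filter_subset _ _

lemma positiveSet_preimage (ε : ℕ → Ω → ℝ) {I A : Finset ℕ} (hA : A ⊆ I) :
    {ω | positiveSet ε I ω = A} =
      ⋂ k ∈ I, ε k ⁻¹' (if k ∈ A then {1} else {1}ᶜ) := by
  ext ω
  simp only [Set.mem_ofPred_eq, Set.mem_iInter, Set.mem_preimage, positiveSet]
  constructor
  · rintro rfl k hk
    by_cases h : ε k ω = 1 <;> simp [hk, h]
  · intro h
    ext k
    rw [Finset.mem_filter]
    constructor
    · rintro ⟨hk, e⟩
      by_contra hkA
      have := h k hk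
      simp [hkA, e] at this
    · intro hkA
      have := h k (hA hkA)
      simp only [hkA, if_true, Set.mem_singleton_iff] at this
      exact ⟨hA hkA, this⟩

lemma IsRademacherSequence.measurableSet_positiveSet {ε : ℕ → Ω → ℝ}
    (h : IsRademacherSequence P ε) {I A : Finset ℕ} (hA : A ⊆ I) :
    MeasurableSet {ω | positiveSet ε I ω = A} := by
  rw [positiveSet_preimage ε hA]
  refine Finset.measurableSet_biInter I fun k _ => h.measurable k ?_
  split_ifs
  exacts [measurableSet_singleton 1, (measurableSet_singleton 1).compl]

lemma IsRademacherSequence.measure_positiveSet {ε : ℕ → Ω → ℝ} (h : IsRademacherSequence P ε)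
    {I A : Finset ℕ} (hA : A ⊆ I) :
    P {ω | positiveSet ε I ω = A} = ENNReal.ofReal ((2⁻¹ : ℝ) ^ I.card) := by
  rw [positiveSet_preimage ε hA, h.indep.measure_inter_preimage_eq_mul I (fun k _ => by
    split_ifs
    exacts [measurableSet_singleton 1, (measurableSet_singleton 1).compl])]
  have : ∀ k ∈ I, P (ε k ⁻¹' (if k ∈ A then {1} else {1}ᶜ)) = ENNReal.ofReal 2⁻¹ := by
    intro k _
    have e : ENNReal.ofReal 2⁻¹ = 1 / 2 := by
      rw [ENNReal.ofReal_inv_of_pos two_pos]; simp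
    have h1 : P (ε k ⁻¹' {1}) = 1 / 2 := h.prob_one k
    split_ifs
    · rw [h1, e]
    · rw [Set.preimage_compl, prob_compl_eq_one_sub (h.measurable k (measurableSet_singleton 1)),
        h1, e]
      simp
  rw [Finset.prod_congr rfl this, Finset.prod_const, ENNReal.ofReal_pow (by norm_num)]

lemma IsRademacherSequence.lintegral_positiveSet {ε : ℕ → Ω → ℝ} (h : IsRademacherSequence P ε)
    (I : Finset ℕ) (F : Finset ℕ → ℝ) (hF : ∀ A, 0 ≤ F A) :
    ∫⁻ ω, ENNReal.ofReal (F (positiveSet ε I ω)) ∂P = ENNReal.ofReal (patternAvg I F) := by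
  have e (ω : Ω) : ENNReal.ofReal (F (positiveSet ε I ω)) = ∑ A ∈ I.powerset,
      {ω | positiveSet ε I ω = A}.indicator (fun _ => ENNReal.ofReal (F A)) ω := by
    rw [Finset.sum_eq_single (positiveSet ε I ω)]
    · simp
    · intro A _ hA
      have hω : ω ∉ {ω | positiveSet ε I ω = A} := fun h' : positiveSet ε I ω = A => hA h'.symm
      simp only [Set.indicator_of_notMem hω]
    · intro h'
      exact absurd (Finset.mem_powerset.2 (positiveSet_subset ε I ω)) h'
  simp_rw [e]
  rw [lintegral_finsetSum]
  · rw [patternAvg, Finset.mul_sum, ENNReal.ofReal_sum_of_nonneg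
      fun A _ => mul_nonneg (by positivity) (hF A)]
    refine Finset.sum_congr rfl fun A hA => ?_
    rw [lintegral_indicator_const (h.measurableSet_positiveSet (Finset.mem_powerset.1 hA)),
      h.measure_positiveSet (Finset.mem_powerset.1 hA), mul_comm,
      ENNReal.ofReal_mul (by positivity)]
  · exact fun A hA =>
      measurable_const.indicator (h.measurableSet_positiveSet (Finset.mem_powerset.1 hA))

variable {𝕜 : Type*} [RCLike 𝕜] {E : Type*} [NormedAddCommGroup E] [NormedSpace 𝕜 E]

lemma patternSum_positiveSet {ε : ℕ → Ω → ℝ} {ω : Ω} (h : ∀ n, ε n ω = 1 ∨ ε n ω = -1)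
    (x : ℕ → E) (I : Finset ℕ) :
    patternSum 𝕜 x I (positiveSet ε I ω) = ∑ k ∈ I, (RCLike.ofReal (ε k ω) : 𝕜) • x k := by
  refine Finset.sum_congr rfl fun k hk => ?_
  congr 2
  rcases h k with e | e
  · simp [patternSign, positiveSet, hk, e]
  · simp [patternSign, positiveSet, e]
    norm_num

lemma IsRademacherSequence.lintegral_comp_norm_sum {ε : ℕ → Ω → ℝ}
    (h : IsRademacherSequence P ε) (x : ℕ → E) (I : Finset ℕ) (H : ℝ → ℝ)
    (hH : ∀ t, 0 ≤ t → 0 ≤ H t) :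
    ∫⁻ ω, ENNReal.ofReal (H ‖∑ k ∈ I, (RCLike.ofReal (ε k ω) : 𝕜) • x k‖) ∂P =
      ENNReal.ofReal (patternAvg I fun A => H ‖patternSum 𝕜 x I A‖) := by
  rw [← h.lintegral_positiveSet I _ fun A => hH _ (norm_nonneg _)]
  refine lintegral_congr_ae ?_
  filter_upwards [h.ae_sign] with ω hω
  rw [patternSum_positiveSet hω]

/-- The norm of the sum is almost surely one fixed measurable function of the sign sequence, and all
Rademacher sequences have the same law. -/
lemma IsRademacherSum.identDistrib_enorm {ε ε' : ℕ → Ω → ℝ} {x : ℕ → E} {X X' : Ω → E}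
    (h : IsRademacherSequence P ε) (h' : IsRademacherSequence P ε')
    (hX : IsRademacherSum 𝕜 P ε x X) (hX' : IsRademacherSum 𝕜 P ε' x X') :
    IdentDistrib (fun ω => ‖X ω‖ₑ) (fun ω => ‖X' ω‖ₑ) P P := by
  -- Each partial sum depends continuously on the signs, so the limsup is measurable even when E is
  -- not separable and X itself is not known to be measurable.
  set L : (ℕ → ℝ) → ℝ≥0∞ := fun e =>
    limsup (fun N : ℕ => ‖∑ n ∈ Finset.range N, (RCLike.ofReal (e n) : 𝕜) • x n‖ₑ) atTop
  have hL : Measurable L := Measurable.limsup fun N => by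
    refine (continuous_enorm.comp (continuous_finsetSum _ fun n _ => ?_)).measurable
    exact (RCLike.continuous_ofReal.comp (continuous_apply n)).smul continuous_const
  have key {ε : ℕ → Ω → ℝ} {X : Ω → E} (hX : IsRademacherSum 𝕜 P ε x X) :
      (fun ω => L fun n => ε n ω) =ᵐ[P] fun ω => ‖X ω‖ₑ := by
    filter_upwards [hX] with ω hω
    exact hω.enorm.limsup_eq
  have hc := (h.identDistrib h').comp hL
  exact ((IdentDistrib.of_ae_eq hc.aemeasurable_fst (key hX)).symm.trans hc).trans
    (IdentDistrib.of_ae_eq hc.aemeasurable_snd (key hX'))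

/-- The contraction principle for the subseries of a Rademacher series indexed by a finite set. -/
lemma IsRademacherSum.lintegral_comp_norm_sum_le {ε : ℕ → Ω → ℝ} {x : ℕ → E} {X : Ω → E}
    (h : IsRademacherSequence P ε) (hX : IsRademacherSum 𝕜 P ε x X) (A : Finset ℕ) (H : ℝ → ℝ)
    (hHm : Measurable H) (hH : MonotoneOn H (Set.Ici 0)) (hHc : ConvexOn ℝ (Set.Ici 0) H) :
    ∫⁻ ω, ENNReal.ofReal (H ‖∑ k ∈ A, (RCLike.ofReal (ε k ω) : 𝕜) • x k‖) ∂P ≤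
      ∫⁻ ω, ENNReal.ofReal (H ‖X ω‖) ∂P := by
  set S : Ω → E := fun ω => ∑ k ∈ A, (RCLike.ofReal (ε k ω) : 𝕜) • x k
  -- Flipping the signs off A turns X into 2S - X with the same law of the norm, and S is the
  -- midpoint of X and 2S - X; convexity and monotonicity of H do the rest.
  have hX' : IsRademacherSum 𝕜 P (fun n ω => patternSign A n * ε n ω) x
      (fun ω => (2 : 𝕜) • S ω - X ω) := by
    filter_upwards [hX] with ω hω
    refine (tendsto_const_nhds.sub hω).congr' ?_
    obtain ⟨M, hM⟩ := A.exists_nat_subset_range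
    filter_upwards [eventually_ge_atTop M] with N hN
    have hA : S ω = ∑ n ∈ Finset.range N,
        if n ∈ A then (RCLike.ofReal (ε n ω) : 𝕜) • x n else 0 := by
      rw [Finset.sum_ite_mem,
        Finset.inter_eq_right.2 (hM.trans (Finset.range_subset_range.2 hN))]
    rw [hA, Finset.smul_sum, ← Finset.sum_sub_distrib]
    refine Finset.sum_congr rfl fun n _ => ?_
    by_cases hn : n ∈ A
    · simp [hn, patternSign, two_smul]
    · simp [hn, patternSign]
  have hid := hX.identDistrib_enorm h (h.patternSign_mul A) hX'
  have hG : Measurable fun t : ℝ≥0∞ => ENNReal.ofReal (2⁻¹ * H t.toReal) :=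
    ENNReal.measurable_ofReal.comp ((hHm.comp ENNReal.measurable_toReal).const_mul _)
  have heq := (hid.comp hG).lintegral_eq
  have haem := (hid.comp hG).aemeasurable_fst
  simp only [Function.comp_def, toReal_enorm] at heq haem
  calc ∫⁻ ω, ENNReal.ofReal (H ‖S ω‖) ∂P
      ≤ ∫⁻ ω, (ENNReal.ofReal (2⁻¹ * H ‖X ω‖) +
          ENNReal.ofReal (2⁻¹ * H ‖(2 : 𝕜) • S ω - X ω‖)) ∂P := by
        refine lintegral_mono fun ω => ?_
        refine (ENNReal.ofReal_le_ofReal ?_).trans ENNReal.ofReal_add_le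
        have h1 : ‖S ω‖ ≤ 2⁻¹ * ‖X ω‖ + 2⁻¹ * ‖(2 : 𝕜) • S ω - X ω‖ := by
          have e : (2 : 𝕜) • S ω = X ω + ((2 : 𝕜) • S ω - X ω) := by abel
          have := norm_add_le (X ω) ((2 : 𝕜) • S ω - X ω)
          rw [← e, norm_smul, RCLike.norm_ofNat] at this
          linarith
        refine (hH (norm_nonneg _) (Set.mem_Ici.2 (by positivity)) h1).trans ?_
        exact hHc.2 (norm_nonneg _) (norm_nonneg _) (by norm_num) (by norm_num) (by norm_num)
    _ = ∫⁻ ω, ENNReal.ofReal (2⁻¹ * H ‖X ω‖) ∂P + ∫⁻ ω, ENNReal.ofReal (2⁻¹ * H ‖X ω‖) ∂P := by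
        rw [lintegral_add_left' haem, heq]
    _ = ∫⁻ ω, ENNReal.ofReal (H ‖X ω‖) ∂P := by
        rw [← lintegral_add_left' haem]
        refine lintegral_congr fun ω => ?_
        rw [← two_mul, ← ENNReal.ofReal_ofNat, ← ENNReal.ofReal_mul zero_le_two]
        congr 1
        ring

lemma IsRademacherSum.aemeasurable_norm {ε : ℕ → Ω → ℝ} {x : ℕ → E} {X : Ω → E}
    (h : IsRademacherSequence P ε) (hX : IsRademacherSum 𝕜 P ε x X) :
    AEMeasurable (fun ω => ‖X ω‖) P := by
  have := (hX.identDistrib_enorm h h hX).aemeasurable_fst.ennreal_toReal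
  simpa using this

end Rademacher

/-! ### Exponential moments of Rademacher series -/

section Bounds

/-- The constant in the exponential moment bound for Rademacher series. -/
noncomputable def momentConst (p : ℝ) : ℝ :=
  1 + 2 * (2 / (1 - (2 : ℝ) ^ (1 - p))) + 2 * (2 ^ p / (1 - (2 : ℝ) ^ (p - 2)))

lemma one_le_momentConst {p : ℝ} (hp : 1 < p) (hp2 : p < 2) : 1 ≤ momentConst p := by
  have h1 : (2 : ℝ) ^ (1 - p) < 1 := Real.rpow_lt_one_of_one_lt_of_neg one_lt_two (by linarith)
  have h2 : (2 : ℝ) ^ (p - 2) < 1 := Real.rpow_lt_one_of_one_lt_of_neg one_lt_two (by linarith)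
  have h3 : 0 ≤ 2 / (1 - (2 : ℝ) ^ (1 - p)) := div_nonneg zero_le_two (by linarith)
  have h4 : 0 ≤ 2 ^ p / (1 - (2 : ℝ) ^ (p - 2)) := div_nonneg (by positivity) (by linarith)
  unfold momentConst
  linarith

variable {𝕜 : Type*} [RCLike 𝕜] {E : Type*} [NormedAddCommGroup E] [NormedSpace 𝕜 E]

lemma abs_patternSign (A : Finset ℕ) (k : ℕ) : |patternSign A k| = 1 := by
  unfold patternSign
  split_ifs <;> simp

lemma re_apply_patternSum (f : StrongDual 𝕜 E) (x : ℕ → E) (I A : Finset ℕ) :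
    RCLike.re (f (patternSum 𝕜 x I A)) = ∑ k ∈ I, patternSign A k * RCLike.re (f (x k)) := by
  simp [patternSum, map_sum]

/-- The exponent collects r from the mean, c₁R twice from truncation (once in dominating the
truncated sums, once in returning to the norm), and 2c₂R from the square correction, where R = r^p ≥
r. -/
theorem patternAvg_exp_norm_le {p m r : ℝ} (hp : 1 < p) (hp2 : p < 2) (hm : 0 < m) (hr : 1 ≤ r)
    (x : ℕ → E) (I : Finset ℕ)
    (hx : ∀ f : StrongDual 𝕜 E, ‖f‖ ≤ 1 → weakLpSeqNorm p (fun n => f (x n)) ≤ ENNReal.ofReal m)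
    (hI : patternAvg I (fun A => ‖patternSum 𝕜 x I A‖) ≤ m) :
    patternAvg I (fun A => Real.exp (r / m * ‖patternSum 𝕜 x I A‖)) ≤
      Real.exp (momentConst p * r ^ p) := by
  set l := r / m with hl
  have hr0 : 0 < r := by linarith
  have hl0 : 0 < l := by positivity
  set R := r ^ p
  have hrR : r ≤ R := Real.self_le_rpow_of_one_le hr hp.le
  set c₁ := 2 / (1 - (2 : ℝ) ^ (1 - p)) with hc₁
  set c₂ := 2 ^ p / (1 - (2 : ℝ) ^ (p - 2)) with hc₂
  let T := {f : StrongDual 𝕜 E // ‖f‖ ≤ 1}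
  set a : T → ℕ → ℝ := fun f k => l * RCLike.re (f.1 (x k)) with ha
  have hcard (f : T) (u : ℝ) (hu : 0 < u) (F : Finset ℕ) (_ : F ⊆ I)
      (hF : ∀ k ∈ F, u ≤ |a f k|) : (F.card : ℝ) ≤ R * u ^ (-p) := by
    have h1 := card_le_of_weakLpSeqNorm_le (u := u / l) (by linarith) hm (by positivity)
      (fun n => f.1 (x n)) (hx f.1 f.2) F (fun k hk => by
        rw [div_le_iff₀ hl0]
        have h2 := hF k hk
        rw [ha, abs_mul, abs_of_pos hl0] at h2
        nlinarith [RCLike.abs_re_le_norm (f.1 (x k))])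
    have e : m / (u / l) = r / u := by rw [hl]; field_simp
    rwa [e, Real.div_rpow hr0.le hu.le, div_eq_mul_inv, ← Real.rpow_neg hu.le] at h1
  -- Truncation at level 1: the dropped entries shift every signed sum by at most c₁R, and the kept
  -- ones have square sum at most c₂R.
  set b : T → ℕ → ℝ := fun f k => if |a f k| ≤ 1 then a f k else 0 with hb
  have hdiff (f : T) (A : Finset ℕ) :
      |∑ k ∈ I, patternSign A k * b f k - l * RCLike.re (f.1 (patternSum 𝕜 x I A))| ≤ c₁ * R := by
    rw [re_apply_patternSum, Finset.mul_sum, ← Finset.sum_sub_distrib]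
    refine (Finset.abs_sum_le_sum_abs _ _).trans ?_
    refine le_trans (le_of_eq ?_) (sum_large_le_of_card_le hp I (fun k => |a f k|) R (hcard f))
    rw [Finset.sum_filter]
    refine Finset.sum_congr rfl fun k _ => ?_
    have e : l * (patternSign A k * RCLike.re (f.1 (x k))) = patternSign A k * a f k := by
      simp only [ha]; ring
    rw [e, ← mul_sub, abs_mul, abs_patternSign, one_mul]
    by_cases h : |a f k| ≤ 1
    · simp [hb, h, not_lt.2 h]
    · simp [hb, h, not_le.1 h]
  have hsq (f : T) : ∑ k ∈ I, 2 * b f k ^ 2 ≤ 2 * (c₂ * R) := by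
    rw [← Finset.mul_sum]
    refine mul_le_mul_of_nonneg_left ?_ zero_le_two
    refine le_trans (le_of_eq ?_) (sum_small_sq_le_of_card_le hp2 I (fun k => |a f k|)
      (fun k => abs_nonneg _) R (hcard f))
    rw [Finset.sum_filter]
    refine Finset.sum_congr rfl fun k _ => ?_
    by_cases h : |a f k| ≤ 1 <;> simp [hb, h]
  have hnorming (A : Finset ℕ) : ∃ f : T,
      RCLike.re (f.1 (patternSum 𝕜 x I A)) = ‖patternSum 𝕜 x I A‖ := by
    obtain ⟨f, hf, hfx⟩ := exists_dual_vector'' 𝕜 (patternSum 𝕜 x I A)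
    exact ⟨⟨f, hf⟩, by simp [hfx]⟩
  -- The selected functional norms the vector sum of its own pattern, so the left side of the
  -- exponential inequality sees the full norm.
  choose τ hτ using hnorming
  have key := patternAvg_exp_le I b (fun _ => 0) τ
    (fun A => l * ‖patternSum 𝕜 x I A‖ + c₁ * R) (fun A _ f => by
      have h1 := (abs_le.1 (hdiff f A)).2
      have h2 : RCLike.re (f.1 (patternSum 𝕜 x I A)) ≤ ‖patternSum 𝕜 x I A‖ :=
        (RCLike.re_le_norm _).trans ((f.1.le_opNorm _).trans
          (mul_le_of_le_one_left (norm_nonneg _) f.2))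
      have h3 := mul_le_mul_of_nonneg_left h2 hl0.le
      linarith)
  rw [patternAvg_add, patternAvg_const_mul, patternAvg_const] at key
  have hlow : patternAvg I (fun A => Real.exp (-(c₁ * R + 2 * (c₂ * R))) *
      Real.exp (l * ‖patternSum 𝕜 x I A‖)) ≤
        Real.exp (l * patternAvg I (fun A => ‖patternSum 𝕜 x I A‖) + c₁ * R) := by
    refine (patternAvg_mono fun A _ => ?_).trans key
    rw [← Real.exp_add, Real.exp_le_exp, Finset.sum_sub_distrib]
    have h1 := (abs_le.1 (hdiff (τ A) A)).1
    have h2 := hsq (τ A)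
    rw [hτ] at h1
    linarith
  rw [patternAvg_const_mul, Real.exp_neg, inv_mul_le_iff₀ (Real.exp_pos _), ← Real.exp_add] at hlow
  refine hlow.trans (Real.exp_le_exp.2 ?_)
  have h1 : l * patternAvg I (fun A => ‖patternSum 𝕜 x I A‖) ≤ r := by
    have h2 := mul_le_mul_of_nonneg_left hI hl0.le
    have e : l * m = r := by rw [hl]; field_simp
    linarith
  rw [momentConst, ← hc₁, ← hc₂]
  linarith

variable {Ω : Type*} [MeasurableSpace Ω] {P : Measure Ω} [IsProbabilityMeasure P]

theorem IsRademacherSum.lintegral_exp_norm_le {p m r : ℝ} (hp : 1 < p) (hp2 : p < 2) (hm : 0 < m)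
    (hr : 1 ≤ r) {ε : ℕ → Ω → ℝ} {x : ℕ → E} {X : Ω → E} (h : IsRademacherSequence P ε)
    (hX : IsRademacherSum 𝕜 P ε x X)
    (hx : ∀ f : StrongDual 𝕜 E, ‖f‖ ≤ 1 → weakLpSeqNorm p (fun n => f (x n)) ≤ ENNReal.ofReal m)
    (hXm : ∫⁻ ω, ‖X ω‖ₑ ∂P ≤ ENNReal.ofReal m) :
    ∫⁻ ω, ENNReal.ofReal (Real.exp (r / m * ‖X ω‖)) ∂P ≤
      ENNReal.ofReal (Real.exp (momentConst p * r ^ p)) := by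
  have hpart (N : ℕ) : ∫⁻ ω, ENNReal.ofReal (Real.exp (r / m *
      ‖∑ k ∈ Finset.range N, (RCLike.ofReal (ε k ω) : 𝕜) • x k‖)) ∂P ≤
        ENNReal.ofReal (Real.exp (momentConst p * r ^ p)) := by
    rw [h.lintegral_comp_norm_sum x _ (fun t => Real.exp (r / m * t))
      fun t _ => (Real.exp_pos _).le]
    refine ENNReal.ofReal_le_ofReal (patternAvg_exp_norm_le hp hp2 hm hr x _ hx ?_)
    -- Contraction with H the identity: partial sums have mean norm at most that of X.
    have h1 := hX.lintegral_comp_norm_sum_le h (Finset.range N) (fun t => t) measurable_id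
      (fun _ _ _ _ hab => hab) (convexOn_id (convex_Ici 0))
    rw [h.lintegral_comp_norm_sum x _ (fun t => t) fun t ht => ht] at h1
    simp only [ofReal_norm] at h1
    exact (ENNReal.ofReal_le_ofReal_iff hm.le).1 (h1.trans hXm)
  set G : ℕ → Ω → ℝ≥0∞ := fun N ω => ENNReal.ofReal (Real.exp (r / m *
      ‖∑ k ∈ Finset.range N, (RCLike.ofReal (ε k ω) : 𝕜) • x k‖)) with hG
  have hmeas (N : ℕ) : Measurable (G N) := by
    have hc : Continuous fun e : ℕ → ℝ => Real.exp (r / m *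
        ‖∑ k ∈ Finset.range N, (RCLike.ofReal (e k) : 𝕜) • x k‖) := by
      refine Real.continuous_exp.comp (continuous_const.mul (continuous_norm.comp
        (continuous_finsetSum _ fun n _ => ?_)))
      exact (RCLike.continuous_ofReal.comp (continuous_apply n)).smul continuous_const
    exact ENNReal.measurable_ofReal.comp (hc.measurable.comp (measurable_pi_iff.2 h.measurable))
  calc ∫⁻ ω, ENNReal.ofReal (Real.exp (r / m * ‖X ω‖)) ∂P
      = ∫⁻ ω, liminf (fun N => G N ω) atTop ∂P := by
        refine lintegral_congr_ae ?_
        filter_upwards [hX] with ω hω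
        have hc : Continuous fun y : E => ENNReal.ofReal (Real.exp (r / m * ‖y‖)) :=
          ENNReal.continuous_ofReal.comp (by fun_prop)
        exact ((hc.tendsto _).comp hω).liminf_eq.symm
    _ ≤ liminf (fun N => ∫⁻ ω, G N ω ∂P) atTop := lintegral_liminf_le hmeas
    _ ≤ liminf (fun _ : ℕ => ENNReal.ofReal (Real.exp (momentConst p * r ^ p))) atTop :=
        liminf_le_liminf (Eventually.of_forall hpart)
    _ = _ := liminf_const _

/-! ### From exponential moments to the Orlicz function -/

/-- A discrete Legendre transform. Only integers j = i + 1 ≥ 1 are used, so that the supremum over j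
can be replaced by a countable sum; the coefficient 2C, twice that of the moment bound, makes this
sum converge. -/
lemma exists_nat_exp_rpow_le {p q C y : ℝ} (hpq : p.HolderConjugate q) (hp2 : p < 2)
    (hC : 1 ≤ C) (hy : 0 ≤ y) :
    ∃ i : ℕ, Real.exp ((y / (8 * C)) ^ q) ≤
      Real.exp 1 + Real.exp ((i + 1 : ℕ) * y - 2 * C * ((i + 1 : ℕ) : ℝ) ^ p) := by
  have hp := hpq.lt
  have hq := hpq.symm.lt
  set u := y / (8 * C) with hu
  have hu0 : 0 ≤ u := by positivity
  have hyu : y = 8 * C * u := by rw [hu]; field_simp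
  rcases le_or_gt u 1 with h1 | h1
  · refine ⟨0, ?_⟩
    have : Real.exp (u ^ q) ≤ Real.exp 1 :=
      Real.exp_le_exp.2 (Real.rpow_le_one hu0 h1 (by linarith))
    have := Real.exp_pos ((0 + 1 : ℕ) * y - 2 * C * ((0 + 1 : ℕ) : ℝ) ^ p)
    linarith
  -- The maximiser of jy - 2Cj^p has the order u^(q-1), as (q-1)(p-1) = 1. Rounding up at most
  -- doubles it, and then 2C j^(p-1) ≤ 4Cu, half of y = 8Cu.
  · set ρ := u ^ (q - 1)
    have hρ : 1 ≤ ρ := Real.one_le_rpow h1.le (by linarith)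
    have hρu : ρ ^ (p - 1) = u := by
      rw [← Real.rpow_mul hu0]
      have : (q - 1) * (p - 1) = 1 := by have := hpq.mul_eq_add; nlinarith
      rw [this, Real.rpow_one]
    have hρq : ρ * u = u ^ q := by
      rw [← Real.rpow_add_one (by linarith)]; ring_nf
    have hceil : 1 ≤ ⌈ρ⌉₊ := Nat.one_le_ceil_iff.2 (by linarith)
    refine ⟨⌈ρ⌉₊ - 1, ?_⟩
    rw [Nat.sub_add_cancel hceil]
    set j : ℝ := (⌈ρ⌉₊ : ℝ)
    have hj1 : ρ ≤ j := Nat.le_ceil ρ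
    have hj2 : j ≤ 2 * ρ := by
      have := Nat.ceil_lt_add_one (show 0 ≤ ρ by linarith)
      change j < _ at this
      linarith
    have hj0 : 0 < j := by linarith
    have hjp : j ^ (p - 1) ≤ 2 * u := by
      calc j ^ (p - 1) ≤ (2 * ρ) ^ (p - 1) := Real.rpow_le_rpow hj0.le hj2 (by linarith)
        _ = 2 ^ (p - 1) * u := by rw [Real.mul_rpow zero_le_two (by linarith), hρu]
        _ ≤ 2 * u := by
            have : (2 : ℝ) ^ (p - 1) ≤ 2 ^ (1 : ℝ) :=
              Real.rpow_le_rpow_of_exponent_le one_le_two (by linarith)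
            rw [Real.rpow_one] at this
            exact mul_le_mul_of_nonneg_right this hu0
    have hjpe : j ^ p = j * j ^ (p - 1) := by
      rw [mul_comm, ← Real.rpow_add_one hj0.ne']; ring_nf
    have hfin : u ^ q ≤ j * y - 2 * C * j ^ p := by
      have h2 : 2 * C * j ^ (p - 1) ≤ 2 * C * (2 * u) :=
        mul_le_mul_of_nonneg_left hjp (by linarith)
      have h3 : u ≤ y - 2 * C * j ^ (p - 1) := by nlinarith
      calc u ^ q = ρ * u := hρq.symm
        _ ≤ j * u := mul_le_mul_of_nonneg_right hj1 hu0
        _ ≤ j * (y - 2 * C * j ^ (p - 1)) := mul_le_mul_of_nonneg_left h3 hj0.le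
        _ = j * y - 2 * C * j ^ p := by rw [hjpe]; ring
    have := Real.exp_le_exp.2 hfin
    linarith [Real.exp_pos 1]

/-- With z = exp(u^q/3) ≥ 1 this reduces to z - 1 ≤ (z³ - 1)/3. -/
lemma orliczPsi_div_three_le {q u : ℝ} (hq : 1 ≤ q) (hu : 0 ≤ u) :
    orliczPsi q (u / 3) ≤ 3⁻¹ * orliczPsi q u := by
  unfold orliczPsi
  have h1 : (u / 3) ^ q ≤ u ^ q / 3 := by
    rw [Real.div_rpow hu (by norm_num)]
    gcongr
    exact Real.self_le_rpow_of_one_le (by norm_num) hq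
  have h2 := Real.exp_le_exp.2 h1
  have h3 : Real.exp (u ^ q) = Real.exp (u ^ q / 3) ^ 3 := by
    rw [← Real.exp_nat_mul]; push_cast; ring_nf
  have h4 : 1 ≤ Real.exp (u ^ q / 3) := Real.one_le_exp (by positivity)
  rw [h3]
  nlinarith [sq_nonneg (Real.exp (u ^ q / 3) - 1)]

lemma orliczPsi_nonneg {q t : ℝ} (ht : 0 ≤ t) : 0 ≤ orliczPsi q t :=
  sub_nonneg.2 (Real.one_le_exp (by positivity))

theorem lintegral_orliczPsi_le_one {p q C : ℝ} (hpq : p.HolderConjugate q) (hp2 : p < 2)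
    (hC : 1 ≤ C) {Y : Ω → ℝ} (hYm : AEMeasurable Y P) (hY : ∀ ω, 0 ≤ Y ω)
    (h : ∀ j : ℕ, 1 ≤ j → ∫⁻ ω, ENNReal.ofReal (Real.exp (j * Y ω)) ∂P ≤
      ENNReal.ofReal (Real.exp (C * (j : ℝ) ^ p))) :
    ∫⁻ ω, ENNReal.ofReal (orliczPsi q (Y ω / (24 * C))) ∂P ≤ 1 := by
  have hp := hpq.lt
  have hterm (i : ℕ) : ∫⁻ ω, ENNReal.ofReal (Real.exp ((i + 1 : ℕ) * Y ω -
      2 * C * ((i + 1 : ℕ) : ℝ) ^ p)) ∂P ≤ (2⁻¹ : ℝ≥0∞) ^ (i + 1) := by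
    have e (ω : Ω) : ENNReal.ofReal (Real.exp ((i + 1 : ℕ) * Y ω -
        2 * C * ((i + 1 : ℕ) : ℝ) ^ p)) = ENNReal.ofReal (Real.exp (-(2 * C *
          ((i + 1 : ℕ) : ℝ) ^ p))) * ENNReal.ofReal (Real.exp ((i + 1 : ℕ) * Y ω)) := by
      rw [← ENNReal.ofReal_mul (Real.exp_pos _).le, ← Real.exp_add]
      ring_nf
    simp_rw [e]
    rw [lintegral_const_mul' _ _ ENNReal.ofReal_ne_top]
    refine (mul_le_mul_right (h (i + 1) (by omega)) _).trans ?_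
    have e2 : (2⁻¹ : ℝ≥0∞) ^ (i + 1) = ENNReal.ofReal ((2⁻¹ : ℝ) ^ (i + 1)) := by
      rw [ENNReal.ofReal_pow (by norm_num), ENNReal.ofReal_inv_of_pos two_pos]
      simp
    rw [← ENNReal.ofReal_mul (Real.exp_pos _).le, ← Real.exp_add, e2]
    refine ENNReal.ofReal_le_ofReal ?_
    have h1 : ((i + 1 : ℕ) : ℝ) ≤ ((i + 1 : ℕ) : ℝ) ^ p :=
      Real.self_le_rpow_of_one_le (by simp) hp.le
    have h2 : -(2 * C * ((i + 1 : ℕ) : ℝ) ^ p) + C * ((i + 1 : ℕ) : ℝ) ^ p ≤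
        (i + 1 : ℕ) * (-1) := by
      nlinarith [show (0 : ℝ) ≤ ((i + 1 : ℕ) : ℝ) ^ p by positivity]
    refine (Real.exp_le_exp.2 h2).trans ?_
    rw [Real.exp_nat_mul]
    refine pow_le_pow_left₀ (Real.exp_pos _).le ?_ _
    rw [Real.exp_neg]
    exact inv_anti₀ two_pos (by linarith [Real.add_one_le_exp 1])
  -- The 4 is 3 ≥ e plus the geometric sum 1. Subtracting 1 leaves 3 for Ψ_q, and the extra factor 3
  -- in 24C brings this down to 1.
  have hfour : ∫⁻ ω, ENNReal.ofReal (Real.exp ((Y ω / (8 * C)) ^ q)) ∂P ≤ 4 := by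
    calc ∫⁻ ω, ENNReal.ofReal (Real.exp ((Y ω / (8 * C)) ^ q)) ∂P
        ≤ ∫⁻ ω, (ENNReal.ofReal (Real.exp 1) + ∑' i : ℕ, ENNReal.ofReal
            (Real.exp ((i + 1 : ℕ) * Y ω - 2 * C * ((i + 1 : ℕ) : ℝ) ^ p))) ∂P := by
          refine lintegral_mono fun ω => ?_
          obtain ⟨i, hi⟩ := exists_nat_exp_rpow_le hpq hp2 hC (hY ω)
          refine (ENNReal.ofReal_le_ofReal hi).trans (ENNReal.ofReal_add_le.trans ?_)
          gcongr
          exact ENNReal.le_tsum (f := fun i : ℕ => ENNReal.ofReal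
            (Real.exp ((i + 1 : ℕ) * Y ω - 2 * C * ((i + 1 : ℕ) : ℝ) ^ p))) i
      _ = ENNReal.ofReal (Real.exp 1) + ∑' i : ℕ, ∫⁻ ω, ENNReal.ofReal
            (Real.exp ((i + 1 : ℕ) * Y ω - 2 * C * ((i + 1 : ℕ) : ℝ) ^ p)) ∂P := by
          rw [lintegral_add_left measurable_const, lintegral_const, measure_univ, mul_one,
            lintegral_tsum fun i => by fun_prop]
      _ ≤ ENNReal.ofReal 3 + ∑' i : ℕ, (2⁻¹ : ℝ≥0∞) ^ (i + 1) := by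
          gcongr with i
          · linarith [Real.exp_one_lt_d9]
          · exact hterm i
      _ = 4 := by
          rw [ENNReal.tsum_geometric_add_one, ENNReal.one_sub_inv_two, inv_inv,
            ENNReal.inv_mul_cancel two_ne_zero ENNReal.ofNat_ne_top]
          norm_num
  have hthree : ∫⁻ ω, ENNReal.ofReal (orliczPsi q (Y ω / (8 * C))) ∂P ≤ 3 := by
    have e (ω : Ω) : ENNReal.ofReal (Real.exp ((Y ω / (8 * C)) ^ q)) =
        1 + ENNReal.ofReal (orliczPsi q (Y ω / (8 * C))) := by
      have h0 : 0 ≤ Y ω / (8 * C) := div_nonneg (hY ω) (by linarith)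
      rw [← ENNReal.ofReal_one, ← ENNReal.ofReal_add zero_le_one (orliczPsi_nonneg h0), orliczPsi]
      ring_nf
    simp_rw [e] at hfour
    rw [lintegral_add_left measurable_const, lintegral_const, measure_univ, mul_one,
      show (4 : ℝ≥0∞) = 1 + 3 by norm_num] at hfour
    exact (ENNReal.add_le_add_iff_left ENNReal.one_ne_top).1 hfour
  calc ∫⁻ ω, ENNReal.ofReal (orliczPsi q (Y ω / (24 * C))) ∂P
      ≤ ∫⁻ ω, ENNReal.ofReal 3⁻¹ * ENNReal.ofReal (orliczPsi q (Y ω / (8 * C))) ∂P := by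
        refine lintegral_mono fun ω => ?_
        rw [← ENNReal.ofReal_mul (by norm_num)]
        refine ENNReal.ofReal_le_ofReal ?_
        have h0 : 0 ≤ Y ω / (8 * C) := div_nonneg (hY ω) (by linarith)
        have e : Y ω / (24 * C) = Y ω / (8 * C) / 3 := by rw [div_div]; ring_nf
        rw [e]
        exact orliczPsi_div_three_le hpq.symm.lt.le h0
    _ ≤ ENNReal.ofReal 3⁻¹ * 3 := by
        rw [lintegral_const_mul' _ _ ENNReal.ofReal_ne_top]
        gcongr
    _ = 1 := by
        rw [ENNReal.ofReal_inv_of_pos (by norm_num), ENNReal.ofReal_ofNat,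
          ENNReal.inv_mul_cancel (by norm_num) ENNReal.ofNat_ne_top]

/-! ### Consequences of a finite Orlicz norm -/

lemma measurable_orliczPsi_div (q c : ℝ) : Measurable fun t => orliczPsi q (t / c) := by
  unfold orliczPsi
  fun_prop

lemma monotoneOn_orliczPsi_div {q c : ℝ} (hq : 0 ≤ q) (hc : 0 < c) :
    MonotoneOn (fun t => orliczPsi q (t / c)) (Set.Ici 0) := fun s hs t _ hst => by
  have hs' : 0 ≤ s / c := div_nonneg hs hc.le
  have ht' : s / c ≤ t / c := by gcongr
  simp only [orliczPsi]
  gcongr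

lemma convexOn_orliczPsi_div {q c : ℝ} (hq : 1 ≤ q) (hc : 0 < c) :
    ConvexOn ℝ (Set.Ici 0) fun t => orliczPsi q (t / c) := by
  refine ⟨convex_Ici 0, fun s hs t ht a b ha hb hab => ?_⟩
  have hs' : s / c ∈ Set.Ici (0 : ℝ) := div_nonneg hs hc.le
  have ht' : t / c ∈ Set.Ici (0 : ℝ) := div_nonneg ht hc.le
  have h1 := (convexOn_rpow hq).2 hs' ht' ha hb hab
  have h2 := convexOn_exp.2 (Set.mem_univ ((s / c) ^ q)) (Set.mem_univ ((t / c) ^ q)) ha hb hab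
  have h3 := (Real.exp_le_exp.2 h1).trans h2
  simp only [smul_eq_mul, orliczPsi] at h3 ⊢
  have e : (a * s + b * t) / c = a * (s / c) + b * (t / c) := by ring
  rw [e]
  linear_combination h3 + hab

lemma le_one_add_orliczPsi {q t : ℝ} (hq : 1 ≤ q) : t ≤ 1 + orliczPsi q t := by
  unfold orliczPsi
  rcases le_total t 1 with h | h
  · rcases le_total t 0 with h0 | h0
    · linarith [Real.exp_pos (t ^ q)]
    · linarith [Real.one_le_exp (show 0 ≤ t ^ q by positivity)]
  · linarith [Real.self_le_rpow_of_one_le h hq, Real.add_one_le_exp (t ^ q)]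

lemma lintegral_enorm_le_of_orliczPsi {q c : ℝ} (hq : 1 ≤ q) (hc : 0 < c) {X : Ω → E}
    (h : ∫⁻ ω, ENNReal.ofReal (orliczPsi q (‖X ω‖ / c)) ∂P ≤ 1) :
    ∫⁻ ω, ‖X ω‖ₑ ∂P ≤ ENNReal.ofReal (2 * c) := by
  calc ∫⁻ ω, ‖X ω‖ₑ ∂P
      ≤ ∫⁻ ω, ENNReal.ofReal c * (1 + ENNReal.ofReal (orliczPsi q (‖X ω‖ / c))) ∂P := by
        refine lintegral_mono fun ω => ?_
        have h0 : 0 ≤ ‖X ω‖ / c := by positivity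
        rw [← ofReal_norm, ← ENNReal.ofReal_one,
          ← ENNReal.ofReal_add zero_le_one (orliczPsi_nonneg h0), ← ENNReal.ofReal_mul hc.le]
        refine ENNReal.ofReal_le_ofReal ?_
        have := mul_le_mul_of_nonneg_left (le_one_add_orliczPsi (t := ‖X ω‖ / c) hq) hc.le
        rwa [mul_div_cancel₀ _ hc.ne'] at this
    _ ≤ ENNReal.ofReal c * (1 + 1) := by
        rw [lintegral_const_mul' _ _ ENNReal.ofReal_ne_top, lintegral_add_left measurable_const,
          lintegral_const, measure_univ, mul_one]
        gcongr
    _ = ENNReal.ofReal (2 * c) := by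
        rw [one_add_one_eq_two, mul_comm 2 c, ENNReal.ofReal_mul hc.le, ENNReal.ofReal_ofNat]

/-- Signs are aligned with the real or the imaginary parts, whichever have the larger absolute sum;
this costs the factor 2. -/
lemma exists_patternSign_sum_norm_le (a : ℕ → 𝕜) (S : Finset ℕ) :
    ∃ A ⊆ S, ∑ k ∈ S, ‖a k‖ ≤ 2 * ‖∑ k ∈ S, (RCLike.ofReal (patternSign A k) : 𝕜) * a k‖ := by
  classical
  have signs (g : ℕ → ℝ) : ∃ A ⊆ S, ∑ k ∈ S, patternSign A k * g k = ∑ k ∈ S, |g k| := by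
    refine ⟨S.filter fun k => 0 ≤ g k, Finset.filter_subset _ _, Finset.sum_congr rfl
      fun k hk => ?_⟩
    by_cases h : 0 ≤ g k
    · simp [patternSign, hk, h, abs_of_nonneg h]
    · simp [patternSign, h, abs_of_neg (not_le.1 h)]
  have hsum : ∑ k ∈ S, ‖a k‖ ≤ ∑ k ∈ S, |RCLike.re (a k)| + ∑ k ∈ S, |RCLike.im (a k)| := by
    rw [← Finset.sum_add_distrib]
    have hI : ‖(RCLike.I : 𝕜)‖ ≤ 1 := by
      by_cases h0 : (RCLike.I : 𝕜) = 0
      · simp [h0]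
      · exact (RCLike.norm_I_of_ne_zero h0).le
    refine Finset.sum_le_sum fun k _ => ?_
    calc ‖a k‖ = ‖((RCLike.re (a k) : ℝ) : 𝕜) + (RCLike.im (a k) : ℝ) * RCLike.I‖ := by
          rw [RCLike.re_add_im]
      _ ≤ |RCLike.re (a k)| + |RCLike.im (a k)| := by
          refine (norm_add_le _ _).trans ?_
          rw [norm_mul, RCLike.norm_ofReal, RCLike.norm_ofReal]
          gcongr
          exact mul_le_of_le_one_right (abs_nonneg _) hI
  obtain ⟨A, hA, hre⟩ := signs fun k => RCLike.re (a k)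
  obtain ⟨B, hB, him⟩ := signs fun k => RCLike.im (a k)
  have h1 : ∑ k ∈ S, |RCLike.re (a k)| ≤
      ‖∑ k ∈ S, (RCLike.ofReal (patternSign A k) : 𝕜) * a k‖ := by
    rw [← hre]
    refine le_trans (le_of_eq ?_) (RCLike.re_le_norm _)
    simp [map_sum]
  have h2 : ∑ k ∈ S, |RCLike.im (a k)| ≤
      ‖∑ k ∈ S, (RCLike.ofReal (patternSign B k) : 𝕜) * a k‖ := by
    rw [← him]
    refine le_trans (le_of_eq ?_) (RCLike.im_le_norm _)
    simp [map_sum]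
  rcases le_total (∑ k ∈ S, |RCLike.re (a k)|) (∑ k ∈ S, |RCLike.im (a k)|) with h | h
  · exact ⟨B, hB, by linarith⟩
  · exact ⟨A, hA, by linarith⟩

lemma le_two_mul_patternAvg_of_nonneg {I : Finset ℕ} {F : Finset ℕ → ℝ} (hF : ∀ A, 0 ≤ F A)
    {A : Finset ℕ} (hA : A ⊆ I) : F A ≤ 2 ^ I.card * patternAvg I F := by
  rw [patternAvg, ← mul_assoc, ← mul_pow, mul_inv_cancel₀ two_ne_zero, one_pow, one_mul]
  exact Finset.single_le_sum (fun B _ => hF B) (Finset.mem_powerset.2 hA)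

lemma IsRademacherSum.rpow_card_mul_le {p q c s : ℝ} (hpq : p.HolderConjugate q) (hc : 0 < c)
    (hs : 0 ≤ s) {ε : ℕ → Ω → ℝ} {x : ℕ → E} {X : Ω → E} (h : IsRademacherSequence P ε)
    (hX : IsRademacherSum 𝕜 P ε x X)
    (hΨ : ∫⁻ ω, ENNReal.ofReal (orliczPsi q (‖X ω‖ / c)) ∂P ≤ 1) (f : StrongDual 𝕜 E)
    (hf : ‖f‖ ≤ 1) {S : Finset ℕ} (hcard : 1 ≤ S.card) (hS : ∀ k ∈ S, s ≤ ‖f (x k)‖) :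
    (S.card : ℝ) ^ (1 / p) * s ≤ 4 * c := by
  have hq := hpq.symm.lt
  have hp := hpq.lt
  set n : ℝ := (S.card : ℝ)
  have hn : 1 ≤ n := Nat.one_le_cast.2 hcard
  have h1 := (hX.lintegral_comp_norm_sum_le h S _ (measurable_orliczPsi_div q c)
    (monotoneOn_orliczPsi_div (by linarith) hc) (convexOn_orliczPsi_div hq.le hc)).trans hΨ
  rw [h.lintegral_comp_norm_sum x S (fun t => orliczPsi q (t / c))
    fun t ht => orliczPsi_nonneg (by positivity), ENNReal.ofReal_le_one] at h1
  obtain ⟨A, hA, hle⟩ := exists_patternSign_sum_norm_le (fun k => f (x k)) S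
  have h2 : n * s / 2 ≤ ‖patternSum 𝕜 x S A‖ := by
    have h3 : n * s ≤ ∑ k ∈ S, ‖f (x k)‖ := by
      simpa [n] using Finset.card_nsmul_le_sum S _ s hS
    have h4 : ∑ k ∈ S, (RCLike.ofReal (patternSign A k) : 𝕜) * f (x k) =
        f (patternSum 𝕜 x S A) := by
      simp [patternSum, map_sum]
    have h5 : ‖f (patternSum 𝕜 x S A)‖ ≤ ‖patternSum 𝕜 x S A‖ :=
      (f.le_opNorm _).trans (mul_le_of_le_one_left (norm_nonneg _) hf)
    rw [h4] at hle
    linarith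
  have h3 : orliczPsi q (n * s / 2 / c) ≤ 2 ^ S.card := by
    calc orliczPsi q (n * s / 2 / c) ≤ orliczPsi q (‖patternSum 𝕜 x S A‖ / c) :=
          monotoneOn_orliczPsi_div (by linarith) hc (Set.mem_Ici.2 (by positivity))
            (norm_nonneg _) h2
      _ ≤ 2 ^ S.card * patternAvg S (fun A => orliczPsi q (‖patternSum 𝕜 x S A‖ / c)) :=
          le_two_mul_patternAvg_of_nonneg
            (F := fun A => orliczPsi q (‖patternSum 𝕜 x S A‖ / c))
            (fun A => orliczPsi_nonneg (by positivity)) hA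
      _ ≤ 2 ^ S.card := mul_le_of_le_one_right (by positivity) h1
  set w := n * s / 2 / c with hw
  have hw0 : 0 ≤ w := by positivity
  have he : (2 : ℝ) ≤ Real.exp 1 := by linarith [Real.add_one_le_exp 1]
  -- Here exp(w^q) ≤ 1 + 2^n ≤ exp(2n), using 2 ≤ e and n ≥ 1.
  have h4 : w ^ q ≤ 2 * n := by
    rw [← Real.exp_le_exp]
    have h5 : (2 : ℝ) ^ S.card ≤ Real.exp n := by
      rw [show n = S.card * 1 by simp [n], Real.exp_nat_mul]
      exact pow_le_pow_left₀ zero_le_two he _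
    have h6 : Real.exp 1 ≤ Real.exp n := Real.exp_le_exp.2 hn
    have h7 : Real.exp (2 * n) = Real.exp n * Real.exp n := by rw [← Real.exp_add]; ring_nf
    unfold orliczPsi at h3
    rw [h7]
    nlinarith
  have h5 : w ≤ 2 * n ^ (1 / q) := by
    have h6 : w ≤ (2 * n) ^ (1 / q) := by
      rw [one_div]
      exact (Real.le_rpow_inv_iff_of_pos hw0 (by positivity) (by linarith)).2 h4
    rw [Real.mul_rpow zero_le_two (by linarith)] at h6
    have h7 : (2 : ℝ) ^ (1 / q) ≤ 2 := by
      have := Real.rpow_le_rpow_of_exponent_le one_le_two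
        (show 1 / q ≤ 1 by rw [div_le_one (by linarith)]; exact hq.le)
      rwa [Real.rpow_one] at this
    exact h6.trans (mul_le_mul_of_nonneg_right h7 (by positivity))
  have h6 : n = n ^ (1 / p) * n ^ (1 / q) := by
    rw [← Real.rpow_add (by linarith), one_div, one_div, hpq.inv_add_inv_eq_one, Real.rpow_one]
  have h7 : n * s = w * (2 * c) := by
    rw [hw, div_mul_eq_mul_div, eq_div_iff hc.ne']
    ring
  have h8 : n ^ (1 / q) * (n ^ (1 / p) * s) ≤ n ^ (1 / q) * (4 * c) := by
    calc n ^ (1 / q) * (n ^ (1 / p) * s) = n * s := by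
          rw [← mul_assoc, mul_comm (n ^ (1 / q)), ← h6]
      _ = w * (2 * c) := h7
      _ ≤ 2 * n ^ (1 / q) * (2 * c) := mul_le_mul_of_nonneg_right h5 (by linarith)
      _ = n ^ (1 / q) * (4 * c) := by ring
  exact le_of_mul_le_mul_left h8 (Real.rpow_pos_of_pos (zero_lt_one.trans_le hn) _)

lemma weakLpSeqNorm_le_of_card {F : Type*} [NormedAddCommGroup F] {p M : ℝ} (a : ℕ → F)
    (h : ∀ s : ℝ, 0 ≤ s → ∀ S : Finset ℕ, 1 ≤ S.card → (∀ k ∈ S, s ≤ ‖a k‖) →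
      (S.card : ℝ) ^ (1 / p) * s ≤ M) : weakLpSeqNorm p a ≤ ENNReal.ofReal M := by
  refine iSup_le fun n => ?_
  have hpos : (0 : ℝ) < ((n + 1 : ℕ) : ℝ) ^ (1 / p) := by positivity
  have h1 : decreasingRearrangement a n ≤ ENNReal.ofReal (M / ((n + 1 : ℕ) : ℝ) ^ (1 / p)) := by
    refine ENNReal.le_of_forall_nnreal_lt fun s hs => ?_
    have h2 : ¬ {k : ℕ | s < ‖a k‖₊}.encard ≤ n := fun h' =>
      absurd hs (not_lt.2 (iInf₂_le s h'))
    have h3 : ((n + 1 : ℕ) : ℕ∞) ≤ {k : ℕ | s < ‖a k‖₊}.encard := by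
      push_cast
      exact Order.add_one_le_of_lt (not_le.1 h2)
    obtain ⟨t, ht, htc⟩ := Set.exists_subset_encard_eq h3
    have hfin : t.Finite := Set.finite_of_encard_eq_coe htc
    have hcard : hfin.toFinset.card = n + 1 := by
      have := hfin.encard_eq_coe_toFinset_card
      rw [htc] at this
      exact_mod_cast this.symm
    have h4 := h s s.2 hfin.toFinset (by omega) fun k hk => by
      have : s < ‖a k‖₊ := ht (hfin.mem_toFinset.1 hk)
      exact_mod_cast this.le
    rw [hcard] at h4
    rw [← ENNReal.ofReal_coe_nnreal]
    refine ENNReal.ofReal_le_ofReal ((le_div_iff₀ hpos).2 ?_)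
    linarith
  calc ((n + 1 : ℕ) : ℝ≥0∞) ^ (1 / p) * decreasingRearrangement a n
      ≤ ((n + 1 : ℕ) : ℝ≥0∞) ^ (1 / p) *
          ENNReal.ofReal (M / ((n + 1 : ℕ) : ℝ) ^ (1 / p)) := by gcongr
    _ = ENNReal.ofReal M := by
        rw [← ENNReal.ofReal_natCast, ENNReal.ofReal_rpow_of_pos (by positivity),
          ← ENNReal.ofReal_mul hpos.le, mul_div_cancel₀ _ hpos.ne']

/-! ### The two inequalities -/

theorem IsRademacherSum.orliczNorm_le {p q : ℝ} (hpq : p.HolderConjugate q) (hp2 : p < 2)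
    {ε : ℕ → Ω → ℝ} {x : ℕ → E} {X : Ω → E} (h : IsRademacherSequence P ε)
    (hX : IsRademacherSum 𝕜 P ε x X) :
    orliczNorm P (orliczPsi q) (fun ω => ‖X ω‖) ≤ ENNReal.ofReal (24 * momentConst p) *
      ((∫⁻ ω, ‖X ω‖ₑ ∂P) +
        ⨆ (f : StrongDual 𝕜 E) (_ : ‖f‖ ≤ 1), weakLpSeqNorm p (fun n => f (x n))) := by
  have hC := one_le_momentConst hpq.lt hp2
  set M := (∫⁻ ω, ‖X ω‖ₑ ∂P) +
    ⨆ (f : StrongDual 𝕜 E) (_ : ‖f‖ ≤ 1), weakLpSeqNorm p (fun n => f (x n)) with hM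
  have hK : ENNReal.ofReal (24 * momentConst p) ≠ 0 := by
    rw [ne_eq, ENNReal.ofReal_eq_zero]
    linarith
  rw [mul_comm, ← ENNReal.div_le_iff_le_mul (Or.inl hK) (Or.inl ENNReal.ofReal_ne_top)]
  -- Working with each b > M gives a positive normalisation even when M = 0, and leaves nothing to
  -- prove when M = ∞.
  refine le_of_forall_gt_imp_ge_of_dense fun b hb => ?_
  rcases eq_or_ne b ⊤ with rfl | hbt
  · exact le_top
  lift b to ℝ≥0 using hbt
  have hb0 : (0 : ℝ) < b := by
    have : (0 : ℝ≥0∞) < b := lt_of_le_of_lt zero_le hb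
    exact_mod_cast this
  have hbe : (b : ℝ≥0∞) = ENNReal.ofReal b := (ENNReal.ofReal_coe_nnreal).symm
  rw [ENNReal.div_le_iff_le_mul (Or.inl hK) (Or.inl ENNReal.ofReal_ne_top), hbe,
    ← ENNReal.ofReal_mul hb0.le]
  have hfin := lintegral_orliczPsi_le_one (P := P) hpq hp2 hC (Y := fun ω => ‖X ω‖ / b)
    ((hX.aemeasurable_norm h).div_const _) (fun ω => by positivity) (fun j hj => by
      have := hX.lintegral_exp_norm_le (r := j) hpq.lt hp2 hb0 (by exact_mod_cast hj) h
        (fun f hf => ?_) ?_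
      · refine le_trans (le_of_eq ?_) this
        refine lintegral_congr fun ω => ?_
        congr 2
        ring
      · rw [← hbe]
        exact ((le_iSup₂ (f := fun (f : StrongDual 𝕜 E) (_ : ‖f‖ ≤ 1) =>
          weakLpSeqNorm p (fun n => f (x n))) f hf).trans le_add_self).trans hb.le
      · rw [← hbe]
        exact le_self_add.trans hb.le)
  refine iInf_le_of_le (b * (24 * momentConst p)) (iInf_le_of_le (by positivity)
    (iInf_le_of_le ?_ le_rfl))
  simpa only [abs_norm, div_div] using hfin

theorem IsRademacherSum.le_orliczNorm {p q : ℝ} (hpq : p.HolderConjugate q)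
    {ε : ℕ → Ω → ℝ} {x : ℕ → E} {X : Ω → E} (h : IsRademacherSequence P ε)
    (hX : IsRademacherSum 𝕜 P ε x X) :
    (∫⁻ ω, ‖X ω‖ₑ ∂P) +
        (⨆ (f : StrongDual 𝕜 E) (_ : ‖f‖ ≤ 1), weakLpSeqNorm p (fun n => f (x n))) ≤
      6 * orliczNorm P (orliczPsi q) (fun ω => ‖X ω‖) := by
  rw [mul_comm, ← ENNReal.div_le_iff_le_mul (Or.inl (by norm_num)) (Or.inl (by norm_num))]
  refine le_iInf fun c => le_iInf₂ fun hc hΨ => ?_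
  simp only [abs_norm] at hΨ
  rw [ENNReal.div_le_iff_le_mul (Or.inl (by norm_num)) (Or.inl (by norm_num))]
  -- The 6 is 2c from the mean plus 4c from the weak norms.
  calc _ ≤ ENNReal.ofReal (2 * c) + ENNReal.ofReal (4 * c) := by
        refine add_le_add (lintegral_enorm_le_of_orliczPsi hpq.symm.lt.le hc hΨ)
          (iSup₂_le fun f hf => ?_)
        exact weakLpSeqNorm_le_of_card _ fun s hs S hcard hS =>
          hX.rpow_card_mul_le hpq hc hs h hΨ f hf hcard hS
    _ = ENNReal.ofReal c * 6 := by
        rw [← ENNReal.ofReal_add (by positivity) (by positivity), ← ENNReal.ofReal_ofNat 6,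
          ← ENNReal.ofReal_mul hc.le]
        ring_nf

end Bounds

theorem corollary4 (p q : ℝ) (hq : 2 < q) (hpq : 1 / p + 1 / q = 1) :
    ∃ C : ℝ≥0, 0 < C ∧
      ∀ (𝕜 : Type*) [RCLike 𝕜] (E : Type*) [NormedAddCommGroup E] [NormedSpace 𝕜 E]
        [CompleteSpace E] (Ω : Type*) [MeasurableSpace Ω] (P : Measure Ω) [IsProbabilityMeasure P]
        (ε : ℕ → Ω → ℝ) (x : ℕ → E) (X : Ω → E),
        IsRademacherSequence P ε → IsRademacherSum 𝕜 P ε x X →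
          (C : ℝ≥0∞)⁻¹ * orliczNorm P (orliczPsi q) (fun ω => ‖X ω‖) ≤
              (∫⁻ ω, ‖X ω‖ₑ ∂P) +
                ⨆ (f : StrongDual 𝕜 E) (_ : ‖f‖ ≤ 1), weakLpSeqNorm p (fun n => f (x n)) ∧
            (∫⁻ ω, ‖X ω‖ₑ ∂P) +
                (⨆ (f : StrongDual 𝕜 E) (_ : ‖f‖ ≤ 1), weakLpSeqNorm p (fun n => f (x n))) ≤
              (C : ℝ≥0∞) * orliczNorm P (orliczPsi q) (fun ω => ‖X ω‖) := by
  have hpq' : p.HolderConjugate q := by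
    refine (Real.holderConjugate_comm.1 ?_)
    rw [Real.holderConjugate_iff]
    refine ⟨by linarith, ?_⟩
    rw [← one_div, ← one_div, add_comm]
    exact hpq
  have hp2 : p < 2 := by
    have h1 := hpq'.mul_eq_add
    have h2 := hpq'.lt
    nlinarith
  have hC := one_le_momentConst hpq'.lt hp2
  have hpos : 0 < 24 * momentConst p := by linarith
  -- This constant also covers the 6 of the other inequality, since `momentConst p` is at least 1.
  refine ⟨Real.toNNReal (24 * momentConst p), Real.toNNReal_pos.2 hpos, ?_⟩
  intro 𝕜 _ E _ _ _ Ω _ P _ ε x X hε hX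
  change (ENNReal.ofReal (24 * momentConst p))⁻¹ * _ ≤ _ ∧
    _ ≤ ENNReal.ofReal (24 * momentConst p) * _
  constructor
  · rw [ENNReal.inv_mul_le_iff (by simpa using hpos) ENNReal.ofReal_ne_top]
    exact hX.orliczNorm_le hpq' hp2 hε
  · refine (hX.le_orliczNorm hpq' hε).trans ?_
    gcongr
    rw [← ENNReal.ofReal_ofNat 6]
    exact ENNReal.ofReal_le_ofReal (by linarith)
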